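/- For $s\in\mathbb{R}$ and $a>0$ let $S_s=\begin{pmatrix}1&s\\0&1\end{pmatrix}$ and $A_a=\begin{pmatrix}a&0\\0&\sqrt a\end{pmatrix}$. For $f\in L^2(\mathbb{R}^2)$ (complex-valued) and $t\in\mathbb{R}^2$ let $f_{ast}\in L^2(\mathbb{R}^2)$ be the function $$f_{ast}(x)=\pi(S_sA_a,t)f(x)=a^{-3/4}f\bigl((S_sA_a)^{-1}(x-t)\bigr).$$ Let $0\neq f\in L^2(\mathbb{R}^2)$. Then the system $\{f_{1nt}\mid n\in\mathbb{Z},\ t\in\mathbb{Z}^2\}$, indexed by the pairs $(n,t)$, is linearly independent over $\mathbb{C}$; that is, if $(n_1,t_1),\dots,(n_r,t_r)\in\mathbb{Z}\times\mathbb{Z}^2$ are distinct and $c_1,\dots,c_r\in\mathbb{C}$ satisfy $\sum_{k=1}^r c_k f_{1n_kt_k}=0$ in $L^2(\mathbb{R}^2)$, then $c_1=\dots=c_r=0$. -/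

import Mathlib

open MeasureTheory

/-- The parabolic dilation matrix `A_a = diag(a, √a)`. -/
noncomputable def dilationMatrix (a : ℝ) : Matrix (Fin 2) (Fin 2) ℝ :=
  !![a, 0; 0, Real.sqrt a]

/-- The shear matrix `S_s`. -/
def shearMatrix (s : ℝ) : Matrix (Fin 2) (Fin 2) ℝ :=
  !![1, s; 0, 1]

/-- The Hilbert space `L²(ℝ²)` of complex-valued square integrable functions. -/
abbrev L2Plane : Type := Lp ℂ 2 (volume : Measure (EuclideanSpace ℝ (Fin 2)))

/-- The function `x ↦ a^(-3/4) f((S_s A_a)⁻¹ (x - t))`. -/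
noncomputable def shearletFun (a s : ℝ) (t : EuclideanSpace ℝ (Fin 2))
    (f : EuclideanSpace ℝ (Fin 2) → ℂ) : EuclideanSpace ℝ (Fin 2) → ℂ :=
  fun x => ((a ^ (-(3 / 4) : ℝ) : ℝ) : ℂ) *
    f (Matrix.toEuclideanLin (shearMatrix s * dilationMatrix a)⁻¹ (x - t))

theorem det_shear_mul_dilation_ne_zero {a : ℝ} (ha : 0 < a) (s : ℝ) :
    (shearMatrix s * dilationMatrix a).det ≠ 0 := by
  have h : Real.sqrt a ≠ 0 := (Real.sqrt_pos.2 ha).ne'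
  simp [shearMatrix, dilationMatrix, Matrix.det_fin_two, ha.ne', h]

theorem memLp_shearletFun {a : ℝ} (ha : 0 < a) (s : ℝ) (t : EuclideanSpace ℝ (Fin 2))
    {f : EuclideanSpace ℝ (Fin 2) → ℂ} (hf : MemLp f 2 volume) :
    MemLp (shearletFun a s t f) 2 volume := by
  set L : EuclideanSpace ℝ (Fin 2) →ₗ[ℝ] EuclideanSpace ℝ (Fin 2) :=
    Matrix.toEuclideanLin (shearMatrix s * dilationMatrix a)⁻¹ with hL
  have hdet : LinearMap.det L ≠ 0 := by
    rw [hL, Matrix.toEuclideanLin, Matrix.toLpLin_eq_toLin, LinearMap.det_toLin, Matrix.det_nonsing_inv,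
      Ring.inverse_eq_inv']
    exact inv_ne_zero (det_shear_mul_dilation_ne_zero ha s)
  have hLm : Measurable L := L.continuous_of_finiteDimensional.measurable
  have h1 : MemLp f 2 (Measure.map L volume) := by
    rw [Measure.map_linearMap_addHaar_eq_smul_addHaar volume hdet]
    exact hf.smul_measure ENNReal.ofReal_ne_top
  have h2 : MemLp (f ∘ L) 2 volume := h1.comp_of_map hLm.aemeasurable
  have h3 : MemLp ((f ∘ L) ∘ fun x => x - t) 2 volume :=
    h2.comp_measurePreserving (measurePreserving_sub_right volume t)
  exact h3.const_mul _

/-- The shearlet transform `f_{ast} = π(S_s A_a, t) f` of `f ∈ L²(ℝ²)`, for `a > 0`: the class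
in `L²(ℝ²)` of the function `x ↦ a^(-3/4) f((S_s A_a)⁻¹ (x - t))`. -/
noncomputable def shearletTransform (a s : ℝ) (ha : 0 < a) (t : EuclideanSpace ℝ (Fin 2))
    (f : L2Plane) : L2Plane :=
  (memLp_shearletFun ha s t (Lp.memLp f)).toLp (shearletFun a s t f)

/-- The vector of `ℝ²` with the integer coordinates `t`. -/
def intVector (t : Fin 2 → ℤ) : EuclideanSpace ℝ (Fin 2) :=
  WithLp.toLp 2 fun i => (t i : ℝ)

/-! The Fourier transform turns a relation into one between modulated shears of `F = 𝓕 f`. On almost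
every vertical line `ξ₀ = x` it reads `∑ j, Q j y * G (y + (a + j) x) = 0`, where `G` is square
integrable and the `Q j` are trigonometric polynomials, 1-periodic in `y` because the translations
are integral. The extreme coefficients are nonzero almost everywhere. Along an orbit `y + ℤx` this
is a recurrence of order `d`. Its ℓ² solutions form a space of dimension at most `d`, so `|u k|² /
‖u‖²` is at most the diagonal entry `w k` of a projection, and `w` has total mass at most `d`
(`exists_recurrence_bound`). Shifting `y` by an integer keeps the recurrence, so the same `w` bounds
the supremum `h` over integer shifts of the normalised density of `G`. Since `h` is 1-periodic, each
of its translates has the same integral `I` over a period; summing `N` of them gives `N * I ≤ d` for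
every `N`, so `I = 0` and `G = 0` (`ae_eq_zero_of_periodic_recurrence`). -/

open scoped ENNReal FourierTransform SchwartzMap

/-! ### Isometries of L² given by unimodular weights and measure preserving maps. -/

section WeightedComposition

variable {α : Type*} [MeasurableSpace α] {μ : Measure α}

theorem memLp_weighted_comp {m : α → ℂ} (hm : Measurable m) (hm1 : ∀ x, ‖m x‖ = 1)
    {φ : α → α} (hφ : MeasurePreserving φ μ μ) {g : α → ℂ} (hg : MemLp g 2 μ) :
    MemLp (fun x => m x * g (φ x)) 2 μ := by
  have h := hg.comp_measurePreserving hφ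
  refine (memLp_congr_norm (hm.aestronglyMeasurable.mul h.1) h.1 ?_).2 h
  exact Filter.Eventually.of_forall fun x => by simp [hm1]

/-- The isometry `g ↦ m • (g ∘ φ)` of `L²(μ)` for unimodular `m` and measure preserving `φ`. -/
noncomputable def weightedComp (m : α → ℂ) (hm : Measurable m) (hm1 : ∀ x, ‖m x‖ = 1)
    (φ : α → α) (hφ : MeasurePreserving φ μ μ) : Lp ℂ 2 μ →ₗᵢ[ℂ] Lp ℂ 2 μ where
  toFun g := (memLp_weighted_comp hm hm1 hφ (Lp.memLp g)).toLp _
  map_add' f g := by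
    rw [← MemLp.toLp_add]
    refine MemLp.toLp_congr _ _ ?_
    filter_upwards [hφ.quasiMeasurePreserving.ae_eq_comp (Lp.coeFn_add f g)] with x hx
    exact (congrArg (m x * ·) hx).trans (mul_add _ _ _)
  map_smul' c g := by
    rw [RingHom.id_apply, ← MemLp.toLp_const_smul]
    refine MemLp.toLp_congr _ _ ?_
    filter_upwards [hφ.quasiMeasurePreserving.ae_eq_comp (Lp.coeFn_smul c g)] with x hx
    simp only [Function.comp_apply, Pi.smul_apply, smul_eq_mul] at hx
    simp [hx, mul_left_comm]
  norm_map' g := by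
    change ‖(memLp_weighted_comp hm hm1 hφ (Lp.memLp g)).toLp _‖ = ‖g‖
    rw [Lp.norm_toLp, Lp.norm_def]
    congr 1
    rw [← eLpNorm_comp_measurePreserving (Lp.aestronglyMeasurable g) hφ]
    exact eLpNorm_congr_norm_ae (Filter.Eventually.of_forall fun x => by simp [hm1])

theorem weightedComp_coeFn {m : α → ℂ} (hm : Measurable m) (hm1 : ∀ x, ‖m x‖ = 1)
    {φ : α → α} (hφ : MeasurePreserving φ μ μ) (g : Lp ℂ 2 μ) :
    weightedComp m hm hm1 φ hφ g =ᵐ[μ] fun x => m x * g (φ x) :=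
  MemLp.coeFn_toLp (memLp_weighted_comp hm hm1 hφ (Lp.memLp g))

theorem weightedComp_ae_eq {m : α → ℂ} (hm : Measurable m) (hm1 : ∀ x, ‖m x‖ = 1)
    {φ : α → α} (hφ : MeasurePreserving φ μ μ) (g : Lp ℂ 2 μ) {g₀ G : α → ℂ}
    (hg : g =ᵐ[μ] g₀) (hG : ∀ x, m x * g₀ (φ x) = G x) :
    weightedComp m hm hm1 φ hφ g =ᵐ[μ] G := by
  filter_upwards [weightedComp_coeFn hm hm1 hφ g,
    hφ.quasiMeasurePreserving.ae_eq_comp hg] with x h1 h2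
  simp only [Function.comp_apply] at h2
  rw [h1, h2, hG]

end WeightedComposition

/-! ### Fourier transform of volume preserving affine substitutions. -/

section FourierAffine

variable {E : Type*} [NormedAddCommGroup E] [InnerProductSpace ℝ E]

/-- The character `ξ ↦ exp(-2πi⟨t, ξ⟩)`. -/
noncomputable def modulation (t : E) : E → ℂ := fun ξ => (Real.fourierChar (-inner ℝ t ξ) : ℂ)

theorem norm_modulation (t ξ : E) : ‖modulation t ξ‖ = 1 := Circle.norm_coe _

variable [MeasurableSpace E] [BorelSpace E]

theorem measurable_modulation (t : E) : Measurable (modulation t) := by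
  unfold modulation
  refine Continuous.measurable ?_
  fun_prop

variable [FiniteDimensional ℝ E]

/-- Change of variables in the Fourier integral. The hypothesis `hLB` makes `B` the adjoint of
`L⁻¹`; volume preservation removes the Jacobian factor. -/
theorem fourier_comp_affine (L : E ≃L[ℝ] E) (hL : MeasurePreserving L volume volume) (t : E)
    {B : E → E} (hLB : ∀ y ξ, inner ℝ (L.symm y) ξ = inner ℝ y (B ξ)) (ψ : E → ℂ) (ξ : E) :
    𝓕 (fun x => ψ (L (x - t))) ξ = modulation t ξ * 𝓕 ψ (B ξ) := by
  rw [Real.fourier_eq, Real.fourier_eq, ← integral_const_mul,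
    ← integral_add_right_eq_self _ t,
    ← hL.integral_comp L.toHomeomorph.measurableEmbedding
      (fun y => modulation t ξ * Real.fourierChar (-inner ℝ y (B ξ)) • ψ y)]
  refine integral_congr_ae (Filter.Eventually.of_forall fun x => ?_)
  have h := hLB (L x) ξ
  rw [L.symm_apply_apply] at h
  simp only [add_sub_cancel_right, inner_add_left, h, neg_add_rev, AddChar.map_add_eq_mul,
    modulation, Circle.smul_def, Circle.coe_mul, smul_eq_mul]
  ring

/-- Both sides are continuous in `f` and agree on the dense range of Schwartz functions, where the
integral formula applies. -/
theorem Lp.fourier_weightedComp_affine (L : E ≃L[ℝ] E) (hL : MeasurePreserving L volume volume)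
    (t : E) {B : E → E} (hB : MeasurePreserving B volume volume)
    (hLB : ∀ y ξ, inner ℝ (L.symm y) ξ = inner ℝ y (B ξ))
    (hLt : MeasurePreserving (fun x => L (x - t)) volume volume)
    (f : Lp ℂ 2 (volume : Measure E)) :
    𝓕 (weightedComp (fun _ => 1) measurable_const (by simp) (fun x => L (x - t)) hLt f) =
      weightedComp (modulation t) (measurable_modulation t) (norm_modulation t) B hB (𝓕 f) := by
  have hd : DenseRange (SchwartzMap.toLpCLM ℝ ℂ 2 (volume : Measure E)) :=
    SchwartzMap.denseRange_toLpCLM ENNReal.ofNat_ne_top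
  refine congrFun (hd.equalizer
    (g := fun f => 𝓕 (weightedComp (fun _ => 1) measurable_const (by simp)
      (fun x => L (x - t)) hLt f))
    (h := fun f => weightedComp (modulation t) (measurable_modulation t) (norm_modulation t) B hB
      (𝓕 f)) ?_ ?_ ?_) f
  · exact (Lp.fourierTransformₗᵢ E ℂ).continuous.comp (LinearIsometry.continuous _)
  · exact (LinearIsometry.continuous _).comp (Lp.fourierTransformₗᵢ E ℂ).continuous
  · funext ψ
    let ψ' : 𝓢(E, ℂ) := SchwartzMap.compSubConstCLM ℂ t
      (SchwartzMap.compCLMOfContinuousLinearEquiv ℂ L ψ)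
    have h1 : weightedComp (fun _ => 1) measurable_const (by simp) (fun x => L (x - t)) hLt
        (ψ.toLp 2 volume) = ψ'.toLp 2 volume := by
      refine Lp.ext ((weightedComp_ae_eq _ _ hLt _ (ψ.coeFn_toLp 2 volume) ?_).trans
        (ψ'.coeFn_toLp 2 volume).symm)
      intro x
      simp [ψ']
    change 𝓕 (weightedComp _ _ _ _ hLt (ψ.toLp 2 volume)) =
      weightedComp _ _ _ B hB (𝓕 (ψ.toLp 2 volume))
    rw [h1, SchwartzMap.toLp_fourier_eq, SchwartzMap.toLp_fourier_eq]
    refine Lp.ext (((𝓕 ψ').coeFn_toLp 2 volume).trans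
      (weightedComp_ae_eq _ _ hB _ ((𝓕 ψ).coeFn_toLp 2 volume) ?_).symm)
    intro ξ
    rw [SchwartzMap.fourier_coe, SchwartzMap.fourier_coe, ← fourier_comp_affine L hL t hLB]
    rfl

end FourierAffine

/-! ### Shears and the Fourier side of the system. -/

/-- The lower triangular shear `ξ ↦ (ξ₀, ξ₁ + s ξ₀)`, the transpose of `shearMatrix s`. -/
noncomputable def shearTranspose (s : ℝ) :
    EuclideanSpace ℝ (Fin 2) →ₗ[ℝ] EuclideanSpace ℝ (Fin 2) :=
  Matrix.toEuclideanLin (shearMatrix s).transpose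

theorem measurePreserving_toEuclideanLin {ι : Type*} [Fintype ι] [DecidableEq ι]
    {M : Matrix ι ι ℝ} (hM : M.det = 1) :
    MeasurePreserving (Matrix.toEuclideanLin M) volume volume := by
  have hdet : LinearMap.det (Matrix.toEuclideanLin M) = 1 := by
    rw [Matrix.toEuclideanLin, Matrix.toLpLin_eq_toLin, LinearMap.det_toLin, hM]
  refine ⟨(LinearMap.continuous_of_finiteDimensional _).measurable, ?_⟩
  rw [Measure.map_linearMap_addHaar_eq_smul_addHaar volume (by simp [hdet])]
  simp [hdet]

theorem det_shearMatrix (s : ℝ) : (shearMatrix s).det = 1 := by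
  simp [shearMatrix, Matrix.det_fin_two]

theorem shearMatrix_mul (s t : ℝ) : shearMatrix s * shearMatrix t = shearMatrix (s + t) := by
  ext i j
  fin_cases i <;> fin_cases j <;> simp [shearMatrix, Matrix.mul_apply, add_comm]

theorem shearMatrix_zero : shearMatrix 0 = 1 := by
  ext i j
  fin_cases i <;> fin_cases j <;> simp [shearMatrix]

theorem inv_shear_mul_dilation_one (s : ℝ) :
    (shearMatrix s * dilationMatrix 1)⁻¹ = shearMatrix (-s) := by
  have : dilationMatrix 1 = 1 := by
    ext i j
    fin_cases i <;> fin_cases j <;> simp [dilationMatrix]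
  rw [this, mul_one]
  exact Matrix.inv_eq_right_inv (by rw [shearMatrix_mul, add_neg_cancel, shearMatrix_zero])

/-- The shear `S_s` as a continuous linear equivalence. -/
noncomputable def shearEquiv (s : ℝ) :
    EuclideanSpace ℝ (Fin 2) ≃L[ℝ] EuclideanSpace ℝ (Fin 2) :=
  LinearEquiv.toContinuousLinearEquiv
    (LinearEquiv.ofLinearMap (Matrix.toEuclideanLin (shearMatrix s))
      (Matrix.toEuclideanLin (shearMatrix (-s)))
      (by ext x i; fin_cases i <;> simp [shearMatrix, Matrix.vecHead, Matrix.vecTail,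
        Matrix.toLpLin_apply, mul_comm])
      (by ext x i; fin_cases i <;> simp [shearMatrix, Matrix.vecHead, Matrix.vecTail,
        Matrix.toLpLin_apply, mul_comm]))

theorem shearletTransform_fourier (n : ℤ) (t : EuclideanSpace ℝ (Fin 2)) (f : L2Plane) :
    (𝓕 (shearletTransform 1 n one_pos t f) : L2Plane) =ᵐ[volume]
      fun ξ => modulation t ξ * (𝓕 f : L2Plane) (shearTranspose n ξ) := by
  have hL : MeasurePreserving (shearEquiv (-n : ℝ)) volume volume :=
    measurePreserving_toEuclideanLin (det_shearMatrix _)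
  have hLt : MeasurePreserving (fun x => shearEquiv (-n : ℝ) (x - t)) volume volume :=
    hL.comp (measurePreserving_sub_right volume t)
  have hB : MeasurePreserving (shearTranspose n) volume volume :=
    measurePreserving_toEuclideanLin (by rw [Matrix.det_transpose, det_shearMatrix])
  have h0 : shearletTransform 1 n one_pos t f =
      weightedComp (fun _ => 1) measurable_const (by simp) _ hLt f := by
    refine MemLp.toLp_congr _ (memLp_weighted_comp measurable_const (by simp) hLt (Lp.memLp f))
      (Filter.Eventually.of_forall fun x => ?_)
    simp only [shearletFun, inv_shear_mul_dilation_one, Real.one_rpow, Complex.ofReal_one]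
    rfl
  have hadj : ∀ y ξ, inner ℝ ((shearEquiv (-n : ℝ)).symm y) ξ = inner ℝ y (shearTranspose n ξ) := by
    intro y ξ
    change inner ℝ (Matrix.toEuclideanLin (shearMatrix (- -n)) y) ξ = _
    rw [neg_neg]
    simp [shearTranspose, shearMatrix, Matrix.toLpLin_apply, PiLp.inner_apply, Matrix.vecHead,
      Matrix.vecTail]
    ring
  rw [h0, Lp.fourier_weightedComp_affine _ hL t hB hadj hLt]
  exact weightedComp_coeFn _ _ hB _

/-! ### Recurrences on ℤ and their square summable solutions. -/

/-- A solution of a linear recurrence of order `d` on `ℤ` with nonvanishing extreme coefficients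
is determined by `d` consecutive values. -/
theorem recurrence_eq_zero {d : ℕ} {p : ℕ → ℤ → ℂ} (h0 : ∀ k, p 0 k ≠ 0) (hd : ∀ k, p d k ≠ 0)
    {u : ℤ → ℂ} (hu : ∀ k : ℤ, ∑ j ∈ Finset.range (d + 1), p j k * u (k + j) = 0)
    (hw : ∀ j < d, u j = 0) : u = 0 := by
  have hwin : ∀ k : ℤ, ∀ j < d, u (k + j) = 0 := by
    intro k
    induction k using Int.induction_on with
    | zero => simpa using hw
    | succ k ih =>
      intro j hj
      rcases Nat.lt_or_ge (j + 1) d with h | h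
      · have := ih (j + 1) h
        push_cast at this
        rwa [add_comm (j : ℤ) 1, ← add_assoc] at this
      · obtain rfl : d = j + 1 := by omega
        have := hu k
        rw [Finset.sum_range_succ, Finset.sum_eq_zero, zero_add] at this
        · have := (mul_eq_zero.1 this).resolve_left (hd _)
          push_cast at this
          rwa [add_comm (j : ℤ) 1, ← add_assoc] at this
        · intro i hi
          rw [ih i (Finset.mem_range.1 hi), mul_zero]
    | pred k ih =>
      intro j hj
      rcases j with _ | j
      · have := hu (-k - 1)
        rw [Finset.sum_range_succ', Finset.sum_eq_zero, zero_add] at this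
        · exact (mul_eq_zero.1 this).resolve_left (h0 _)
        · intro i hi
          have := ih i (Finset.mem_range.1 hi)
          push_cast
          rw [show (-k - 1 + (i + 1) : ℤ) = -k + i by ring, this, mul_zero]
      · have := ih j (by omega)
        push_cast
        rwa [show (-k - 1 + (j + 1) : ℤ) = -k + j by ring]
  funext k
  -- The equation at `k - d` has `u k` as its last term. This also covers `d = 0`, where `hwin` is
  -- empty.
  have := hu (k - d)
  rw [Finset.sum_range_succ, Finset.sum_eq_zero, zero_add] at this
  · simpa using (mul_eq_zero.1 this).resolve_left (hd _)
  · intro i hi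
    rw [hwin _ i (Finset.mem_range.1 hi), mul_zero]

/-- The diagonal of the orthogonal projection onto a finite-dimensional subspace of `ℓ²` has sum
at most the dimension and bounds the coordinates of the vectors of the subspace. -/
theorem exists_diagonal_bound (W : Submodule ℂ (lp (fun _ : ℤ => ℂ) 2)) [FiniteDimensional ℂ W] :
    ∃ w : ℤ → ℝ, (∀ F : Finset ℤ, ∑ k ∈ F, w k ≤ Module.finrank ℂ W) ∧
      ∀ v ∈ W, ∀ k, ‖v k‖ ^ 2 ≤ w k * ‖v‖ ^ 2 := by
  let b := stdOrthonormalBasis ℂ W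
  have hb : Orthonormal ℂ fun i => (b i : lp (fun _ : ℤ => ℂ) 2) :=
    b.orthonormal.comp_linearIsometry W.subtypeₗᵢ
  refine ⟨fun k => ∑ i, ‖(b i : lp (fun _ : ℤ => ℂ) 2) k‖ ^ 2, fun F => ?_, fun v hv k => ?_⟩
  · rw [Finset.sum_comm]
    calc ∑ i, ∑ k ∈ F, ‖(b i : lp (fun _ : ℤ => ℂ) 2) k‖ ^ 2
        ≤ ∑ i : Fin (Module.finrank ℂ W), (1 : ℝ) := by
          refine Finset.sum_le_sum fun i _ => ?_
          have := lp.sum_rpow_le_norm_rpow (p := 2) (by simp) (b i : lp (fun _ : ℤ => ℂ) 2) F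
          simpa [hb.1 i] using this
      _ = Module.finrank ℂ W := by simp
  · have h1 : v k = ∑ i, b.repr ⟨v, hv⟩ i * (b i : lp (fun _ : ℤ => ℂ) 2) k := by
      have := congrArg (fun z : W => (z : lp (fun _ : ℤ => ℂ) 2) k) (b.sum_repr ⟨v, hv⟩)
      simp only [Submodule.coe_sum, lp.coeFn_sum, Finset.sum_apply] at this
      exact this.symm
    have h2 : ‖v‖ ^ 2 = ∑ i, ‖b.repr ⟨v, hv⟩ i‖ ^ 2 := by
      rw [← EuclideanSpace.norm_sq_eq, LinearIsometryEquiv.norm_map]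
      rfl
    rw [h1, h2]
    calc _ ≤ (∑ i, ‖b.repr ⟨v, hv⟩ i‖ * ‖(b i : lp (fun _ : ℤ => ℂ) 2) k‖) ^ 2 := by
          gcongr
          exact (norm_sum_le _ _).trans (by simp)
      _ ≤ _ := Finset.sum_mul_sq_le_sq_mul_sq _ _ _
      _ = _ := mul_comm _ _

/-- The square summable solutions of a recurrence of order `d` concentrate on at most `d` points,
uniformly in the solution. -/
theorem exists_recurrence_bound {d : ℕ} {p : ℕ → ℤ → ℂ} (h0 : ∀ k, p 0 k ≠ 0)
    (hd : ∀ k, p d k ≠ 0) :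
    ∃ w : ℤ → ℝ≥0∞, (∀ F : Finset ℤ, ∑ k ∈ F, w k ≤ d) ∧
      ∀ u : ℤ → ℂ, (∀ k : ℤ, ∑ j ∈ Finset.range (d + 1), p j k * u (k + j) = 0) →
        ∀ k, ‖u k‖ₑ ^ 2 / ∑' l, ‖u l‖ₑ ^ 2 ≤ w k := by
  let W : Submodule ℂ (lp (fun _ : ℤ => ℂ) 2) :=
    { carrier := {v | ∀ k : ℤ, ∑ j ∈ Finset.range (d + 1), p j k * v (k + j) = 0}
      zero_mem' := by simp
      add_mem' := by
        intro v v' hv hv' k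
        simp only [lp.coeFn_add, Pi.add_apply, mul_add, Finset.sum_add_distrib, hv k, hv' k,
          add_zero]
      smul_mem' := by
        intro c v hv k
        simp only [lp.coeFn_smul, Pi.smul_apply, smul_eq_mul, mul_left_comm _ c,
          ← Finset.mul_sum, hv k, mul_zero] }
  let T : W →ₗ[ℂ] (Fin d → ℂ) :=
    { toFun := fun v j => (v : lp (fun _ : ℤ => ℂ) 2) (j : ℤ)
      map_add' := fun v v' => by ext; simp
      map_smul' := fun c v => by ext; simp }
  have hT : Function.Injective T := by
    rw [← LinearMap.ker_eq_bot, LinearMap.ker_eq_bot']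
    intro v hv
    have := recurrence_eq_zero h0 hd (u := (v : lp (fun _ : ℤ => ℂ) 2)) v.2
      fun j hj => congrFun hv ⟨j, hj⟩
    exact Subtype.ext (lp.ext this)
  have : FiniteDimensional ℂ W := FiniteDimensional.of_injective T hT
  have hrank : Module.finrank ℂ W ≤ d := by
    simpa using LinearMap.finrank_le_finrank_of_injective hT
  obtain ⟨w, hw, hwv⟩ := exists_diagonal_bound W
  refine ⟨fun k => ENNReal.ofReal (max (w k) 0), fun F => ?_, fun u hu k => ?_⟩
  · rw [← ENNReal.ofReal_sum_of_nonneg fun _ _ => le_max_right _ _]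
    refine ENNReal.ofReal_le_of_le_toReal ?_
    have h := hw (F.filter fun k => 0 ≤ w k)
    rw [Finset.sum_filter] at h
    refine le_trans (Finset.sum_le_sum fun k _ => ?_) (h.trans (by simpa using hrank))
    split_ifs with hk
    · exact (max_eq_left hk).le
    · exact (max_eq_right (not_le.1 hk).le).le
  -- If `u` is not square summable, the quotient by `∞` is `0`.
  · by_cases hs : ∑' l, ‖u l‖ₑ ^ 2 = ∞
    · simp [hs]
    have hmem : Memℓp u 2 := by
      refine memℓp_gen ?_
      have : Summable fun l => (‖u l‖ₑ ^ 2).toReal := ENNReal.summable_toReal hs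
      simpa using this
    let v : lp (fun _ : ℤ => ℂ) 2 := ⟨u, hmem⟩
    have hv : ∑' l, ‖u l‖ₑ ^ 2 = ENNReal.ofReal (‖v‖ ^ 2) := by
      have h1 := lp.norm_rpow_eq_tsum (p := 2) (by simp) v
      have h2 : ‖v‖ ^ 2 = ∑' l, (‖u l‖ₑ ^ 2).toReal := by
        simpa [v] using h1
      rw [h2, ← ENNReal.tsum_toReal_eq fun l => by simp, ENNReal.ofReal_toReal hs]
    have h := hwv v hu k
    refine ENNReal.div_le_of_le_mul ?_
    rw [hv, ← ENNReal.ofReal_mul (le_max_right _ _)]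
    calc ‖u k‖ₑ ^ 2 = ENNReal.ofReal (‖u k‖ ^ 2) := by
          rw [ENNReal.ofReal_pow (norm_nonneg _), ofReal_norm]
      _ ≤ _ := ENNReal.ofReal_le_ofReal
          (h.trans (mul_le_mul_of_nonneg_right (le_max_left _ _) (by positivity)))

/-! ### Integration along orbits of translations of the line. -/

theorem setLIntegral_Ioc_add_right (f : ℝ → ℝ≥0∞) (a b c : ℝ) :
    ∫⁻ y in Set.Ioc a b, f (y + c) = ∫⁻ y in Set.Ioc (a + c) (b + c), f y := by
  have h := (measurePreserving_add_right (volume : Measure ℝ) c).setLIntegral_comp_preimage_emb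
    (measurableEmbedding_addRight c) f (Set.Ioc (a + c) (b + c))
  rwa [Set.preimage_add_const_Ioc, add_sub_cancel_right, add_sub_cancel_right] at h

/-- Unfolding: the integral of the orbit sum over one period is the integral of `F` over the line.
-/
theorem ae_tsum_zmultiples_lt_top {F : ℝ → ℝ≥0∞} (hF : Measurable F) (hfin : ∫⁻ y, F y ≠ ∞)
    {x : ℝ} (hx : x ≠ 0) : ∀ᵐ y : ℝ, ∑' l : ℤ, F (y + l * x) < ∞ := by
  have pos : ∀ T : ℝ, 0 < T → ∀ᵐ y : ℝ, ∑' l : ℤ, F (y + l * T) < ∞ := by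
    intro T hT
    have hun : ⋃ n : ℤ, Set.Ioc (n • T) ((n + 1) • T) = Set.univ := iUnion_Ioc_zsmul hT
    rw [← Measure.restrict_univ (μ := (volume : Measure ℝ)), ← hun, ae_restrict_iUnion_iff]
    intro m
    refine ae_lt_top (Measurable.tsum fun l => by fun_prop) ?_
    rw [lintegral_tsum fun l => by fun_prop]
    have : ∑' l : ℤ, ∫⁻ y in Set.Ioc (m • T) ((m + 1) • T), F (y + l * T) = ∫⁻ y, F y := by
      rw [← setLIntegral_univ, ← hun, lintegral_iUnion (fun _ => measurableSet_Ioc)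
        (Set.pairwise_disjoint_Ioc_zsmul T), ← (Equiv.addLeft m).tsum_eq
          fun l : ℤ => ∫⁻ y in Set.Ioc (l • T) ((l + 1) • T), F y]
      refine tsum_congr fun l => ?_
      rw [setLIntegral_Ioc_add_right]
      congr 3 <;> simp only [zsmul_eq_mul, Equiv.coe_addLeft] <;> push_cast <;> ring
    rwa [this]
  rcases hx.lt_or_gt with h | h
  · filter_upwards [pos (-x) (by linarith)] with y hy
    rw [← (Equiv.neg ℤ).tsum_eq]
    simpa using hy
  · exact pos x h

theorem setLIntegral_Ioc_periodic {h : ℝ → ℝ≥0∞} (hh : Function.Periodic h 1) (t : ℝ) :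
    ∫⁻ y in Set.Ioc t (t + 1), h y = ∫⁻ b : UnitAddCircle, hh.lift b := by
  rw [← UnitAddCircle.lintegral_preimage t hh.lift]
  rfl

/-- Superadditivity of the lower integral needs no measurability. -/
theorem sum_lintegral_le {α ι : Type*} [MeasurableSpace α] {μ : Measure α} (s : Finset ι)
    (f : ι → α → ℝ≥0∞) : ∑ i ∈ s, ∫⁻ a, f i a ∂μ ≤ ∫⁻ a, ∑ i ∈ s, f i a ∂μ := by
  classical
  induction s using Finset.induction_on with
  | empty => simp
  | insert i s hi ih =>
    simp only [Finset.sum_insert hi]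
    exact (add_le_add_right ih _).trans (le_lintegral_add _ _)

/-- A `1`-periodic function, not assumed measurable, whose sums over the orbits of a translation
are bounded has vanishing lower integral. -/
theorem lintegral_eq_zero_of_orbit_sum_le {h : ℝ → ℝ≥0∞} (hh : Function.Periodic h 1) (x : ℝ)
    (d : ℕ) (hsum : ∀ᵐ y : ℝ, ∀ N : ℕ, ∑ k ∈ Finset.range N, h (y + k * x) ≤ d) (t : ℝ) :
    ∫⁻ y in Set.Ioc t (t + 1), h y = 0 := by
  set I := ∫⁻ b : UnitAddCircle, hh.lift b with hI
  have hshift : ∀ c : ℝ, ∫⁻ y in Set.Ioc t (t + 1), h (y + c) = I := by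
    intro c
    rw [setLIntegral_Ioc_add_right, show t + 1 + c = t + c + 1 by ring,
      setLIntegral_Ioc_periodic hh]
  have hN : ∀ N : ℕ, N * I ≤ d := by
    intro N
    calc N * I = ∑ k ∈ Finset.range N, ∫⁻ y in Set.Ioc t (t + 1), h (y + k * x) := by
          simp [hshift]
      _ ≤ ∫⁻ y in Set.Ioc t (t + 1), ∑ k ∈ Finset.range N, h (y + k * x) :=
          sum_lintegral_le _ _
      _ ≤ ∫⁻ y in Set.Ioc t (t + 1), (d : ℝ≥0∞) :=
          lintegral_mono_ae (ae_restrict_of_ae (hsum.mono fun y hy => hy N))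
      _ = d := by simp
  rw [setLIntegral_Ioc_periodic hh]
  by_contra hne
  obtain ⟨N, hlt⟩ := ENNReal.exists_nat_mul_gt hne (ENNReal.natCast_ne_top d)
  exact (hlt.trans_le (hN N)).false

theorem ae_forall_int_add_mul {P : ℝ → Prop} (hP : ∀ᵐ y : ℝ, P y) (x : ℝ) :
    ∀ᵐ y : ℝ, ∀ m k : ℤ, P (y + m + k * x) := by
  rw [ae_all_iff]
  intro m
  rw [ae_all_iff]
  intro k
  have := (measurePreserving_add_right (volume : Measure ℝ) (m + k * x)).quasiMeasurePreserving.ae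
    hP
  simpa only [add_assoc] using this

/-- A square integrable function on the line satisfying a nontrivial finite difference equation
with `1`-periodic coefficients vanishes almost everywhere. -/
theorem ae_eq_zero_of_periodic_recurrence {x : ℝ} (hx : x ≠ 0) {d : ℕ} {a : ℤ} {Q : ℕ → ℝ → ℂ}
    (hQ : ∀ j, Function.Periodic (Q j) 1) (h0 : ∀ᵐ y : ℝ, Q 0 y ≠ 0) (hd : ∀ᵐ y : ℝ, Q d y ≠ 0)
    {G : ℝ → ℂ} (hG : Measurable G) (hG2 : ∫⁻ y, ‖G y‖ₑ ^ 2 ≠ ∞)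
    (hrel : ∀ᵐ y : ℝ, ∑ j ∈ Finset.range (d + 1), Q j y * G (y + (a + j : ℤ) * x) = 0) :
    ∀ᵐ y : ℝ, G y = 0 := by
  let S : ℝ → ℝ≥0∞ := fun y => ∑' l : ℤ, ‖G (y + l * x)‖ₑ ^ 2
  let q : ℝ → ℝ≥0∞ := fun y => ‖G y‖ₑ ^ 2 / S y
  let h : ℝ → ℝ≥0∞ := fun y => ⨆ m : ℤ, q (y + m)
  have hqm : Measurable q :=
    (by fun_prop : Measurable fun y => ‖G y‖ₑ ^ 2).div
      (Measurable.tsum fun l => by fun_prop)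
  have hh : Function.Periodic h 1 := by
    intro y
    refine (Equiv.addLeft (1 : ℤ)).iSup_congr fun m => ?_
    simp [add_assoc]
  have hsum : ∀ᵐ y : ℝ, ∀ N : ℕ, ∑ k ∈ Finset.range N, h (y + k * x) ≤ d := by
    filter_upwards [ae_forall_int_add_mul h0 x, ae_forall_int_add_mul hd x,
      ae_forall_int_add_mul hrel x] with y hy0 hyd hyr N
    obtain ⟨w, hw, hwu⟩ := exists_recurrence_bound
      -- The shift by `a` makes the recurrence at `k` start with `u k`.
      (p := fun j k => Q j (y + ((k - a : ℤ) : ℝ) * x))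
      (fun k => by simpa using hy0 0 (k - a)) (fun k => by simpa using hyd 0 (k - a))
    refine le_trans ?_ (hw ((Finset.range N).map Nat.castEmbedding))
    rw [Finset.sum_map]
    -- By periodicity the solutions based at `y` and at `y + m` obey the same recurrence, so one `w`
    -- bounds every integer shift of `q`.
    refine Finset.sum_le_sum fun k _ => iSup_le fun m => ?_
    have h1 := hwu (fun l => G (y + m + l * x)) (fun l => by
      rw [← hyr m (l - a)]
      refine Finset.sum_congr rfl fun j _ => ?_
      have hper := ((hQ j).int_mul m) (y + ((l - a : ℤ) : ℝ) * x)
      rw [mul_one] at hper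
      congr 1
      · rw [← hper]
        congr 1
        ring
      · congr 1
        push_cast
        ring) k
    refine le_of_eq_of_le ?_ h1
    have e : y + k * x + m = y + m + ((k : ℤ) : ℝ) * x := by push_cast; ring
    simp only [q, S, e]
    congr 1
    rw [← (Equiv.addLeft (k : ℤ)).tsum_eq (fun l : ℤ => ‖G (y + m + l * x)‖ₑ ^ 2)]
    refine tsum_congr fun l => ?_
    simp only [Equiv.coe_addLeft]
    congr 3
    push_cast
    ring
  have hq0 : ∀ᵐ y : ℝ, q y = 0 := by
    rw [← Measure.restrict_univ (μ := (volume : Measure ℝ)), ← iUnion_Ioc_intCast ℝ,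
      ae_restrict_iUnion_iff]
    intro m
    refine (lintegral_eq_zero_iff hqm).1 (le_antisymm ?_ zero_le)
    rw [← lintegral_eq_zero_of_orbit_sum_le hh x d hsum m]
    exact lintegral_mono fun y => by simpa using le_iSup (fun m : ℤ => q (y + m)) 0
  filter_upwards [hq0, ae_tsum_zmultiples_lt_top (F := fun y => ‖G y‖ₑ ^ 2) (by fun_prop) hG2 hx]
    with y hy hS
  -- A zero quotient means `G y = 0` or `S y = ∞`; the latter is excluded almost everywhere.
  rcases ENNReal.div_eq_zero_iff.1 hy with h1 | h1
  · simpa using h1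
  · exact absurd h1 hS.ne

/-! ### Zero sets of trigonometric polynomials. -/

/-- The character `y ↦ exp(-2πi m y)` of the line. -/
noncomputable def lineChar (m : ℤ) (y : ℝ) : ℂ :=
  Complex.exp (((-2 * Real.pi * m : ℝ) * Complex.I) * y)

theorem lineChar_add (m : ℤ) (y z : ℝ) : lineChar m (y + z) = lineChar m y * lineChar m z := by
  simp only [lineChar, ← Complex.exp_add]
  push_cast
  ring_nf

theorem lineChar_periodic (m : ℤ) : Function.Periodic (lineChar m) 1 := by
  intro y
  rw [lineChar_add]
  have : lineChar m 1 = 1 := by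
    rw [lineChar, Complex.exp_eq_one_iff]
    exact ⟨-m, by push_cast; ring⟩
  rw [this, mul_one]

theorem lineChar_injective : Function.Injective lineChar := by
  intro m n h
  by_contra hne
  have hmn : ((m : ℂ) - n) ≠ 0 := sub_ne_zero.2 (by exact_mod_cast hne)
  -- At this point the ratio of the two characters is `exp(-πi) = -1`.
  have h1 := congrFun h (1 / (2 * (m - n)))
  have h2 : Complex.exp (-(Real.pi * Complex.I)) = 1 := by
    rw [lineChar, lineChar, Complex.exp_eq_exp_iff_exp_sub_eq_one] at h1
    rw [← h1]
    congr 1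
    push_cast
    field_simp
    ring
  rw [Complex.exp_neg, Complex.exp_pi_mul_I] at h2
  norm_num at h2

/-- The character `y ↦ exp(-2πi m y)` as a monoid homomorphism. -/
noncomputable def lineCharHom (m : ℤ) : Multiplicative ℝ →* ℂ where
  toFun y := lineChar m y.toAdd
  map_one' := by simp [lineChar]
  map_mul' y z := lineChar_add m _ _

theorem linearIndependent_lineChar : LinearIndependent ℂ lineChar := by
  have hinj : Function.Injective lineCharHom := fun m n h =>
    lineChar_injective (funext fun y => DFunLike.congr_fun h (Multiplicative.ofAdd y))
  exact (linearIndependent_monoidHom (Multiplicative ℝ) ℂ).comp _ hinj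

/-- Independence of the characters gives a point of nonvanishing; zeros of a real analytic function
that is not identically zero form a null set. -/
theorem ae_trigPolynomial_ne_zero {ι : Type*} {s : Finset ι} {c : ι → ℂ} {φ : ι → ℤ}
    (hφ : Set.InjOn φ s) (hc : ∃ i ∈ s, c i ≠ 0) :
    ∀ᵐ y : ℝ, ∑ i ∈ s, c i * lineChar (φ i) y ≠ 0 := by
  obtain ⟨i, hi, hci⟩ := hc
  have hli : LinearIndepOn ℂ (fun i => lineChar (φ i)) (s : Set ι) :=
    linearIndependent_lineChar.comp (fun i : s => φ i) fun i j h => Subtype.ext (hφ i.2 j.2 h)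
  have hex : ∃ y : ℝ, ∑ i ∈ s, c i * lineChar (φ i) y ≠ 0 := by
    by_contra! hall
    refine hci (linearIndepOn_finset_iff.1 hli c ?_ i hi)
    funext y
    simpa using hall y
  obtain ⟨y₀, hy₀⟩ := hex
  have han : AnalyticOnNhd ℝ (fun y : ℝ => ∑ i ∈ s, c i * lineChar (φ i) y) Set.univ := by
    intro y _
    refine Finset.analyticAt_fun_sum _ fun i _ => ?_
    refine analyticAt_const.mul ?_
    unfold lineChar
    exact analyticAt_cexp.restrictScalars.fun_comp
      (analyticAt_const.mul (Complex.ofRealCLM.analyticAt y))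
  have h := han.preimage_zero_mem_codiscrete hy₀
  have h2 := ae_restrict_le_codiscreteWithin (μ := (volume : Measure ℝ)) MeasurableSet.univ h
  rw [Measure.restrict_univ] at h2
  exact h2

/-- Grouping by the frequency in `y`, the coefficient of one frequency is a nontrivial polynomial in
`x`, hence nonzero for almost every `x`. -/
theorem ae_ae_trigPolynomial_ne_zero {ι : Type*} {s : Finset ι} {c : ι → ℂ} {τ : ι → Fin 2 → ℤ}
    (hτ : Set.InjOn τ s) (hs : s.Nonempty) (hc : ∀ p ∈ s, c p ≠ 0) :
    ∀ᵐ x : ℝ, ∀ᵐ y : ℝ,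
      ∑ p ∈ s, c p * (lineChar (τ p 0) x * lineChar (τ p 1) y) ≠ 0 := by
  obtain ⟨p₀, hp₀⟩ := hs
  have h1 := ae_trigPolynomial_ne_zero (s := s.filter fun p => τ p 1 = τ p₀ 1) (c := c)
    (φ := fun p => τ p 0) (by
      intro p hp p' hp' h
      rw [Finset.mem_coe, Finset.mem_filter] at hp hp'
      refine hτ hp.1 hp'.1 (funext fun i => ?_)
      fin_cases i
      · exact h
      · exact hp.2.trans hp'.2.symm) ⟨p₀, by simp [hp₀], hc _ hp₀⟩
  filter_upwards [h1] with x hx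
  have h2 := ae_trigPolynomial_ne_zero (s := s.image fun p => τ p 1)
    (c := fun m => ∑ p ∈ s with τ p 1 = m, c p * lineChar (τ p 0) x) (φ := id)
    Function.injective_id.injOn ⟨τ p₀ 1, Finset.mem_image_of_mem _ hp₀, hx⟩
  filter_upwards [h2] with y hy
  convert hy using 1
  rw [← Finset.sum_fiberwise_of_maps_to (g := fun p => τ p 1)
    (t := s.image fun p => τ p 1) fun p hp => Finset.mem_image_of_mem _ hp]
  refine Finset.sum_congr rfl fun m _ => ?_
  rw [Finset.sum_mul]
  refine Finset.sum_congr rfl fun p hp => ?_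
  rw [(Finset.mem_filter.1 hp).2, id, mul_assoc]

/-! ### From the plane to vertical lines, and the conclusion. -/

theorem modulation_intVector (t : Fin 2 → ℤ) (ξ : EuclideanSpace ℝ (Fin 2)) :
    modulation (intVector t) ξ = lineChar (t 0) (ξ 0) * lineChar (t 1) (ξ 1) := by
  simp only [modulation, lineChar, Real.fourierChar_apply, ← Complex.exp_add, intVector,
    PiLp.inner_apply, Fin.sum_univ_two, RCLike.inner_apply, conj_trivial]
  congr 1
  push_cast
  ring

/-- The point of the Euclidean plane with given coordinates. -/
noncomputable def planePoint (z : ℝ × ℝ) : EuclideanSpace ℝ (Fin 2) := !₂[z.1, z.2]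

theorem measurePreserving_planePoint : MeasurePreserving planePoint volume volume :=
  ((EuclideanSpace.volume_preserving_symm_measurableEquiv_toLp (Fin 2)).symm _).comp
    ((volume_preserving_finTwoArrow ℝ).symm _)

theorem measurePreserving_planeCoords :
    MeasurePreserving (fun ξ : EuclideanSpace ℝ (Fin 2) => (ξ 0, ξ 1)) volume volume :=
  (volume_preserving_finTwoArrow ℝ).comp
    (EuclideanSpace.volume_preserving_symm_measurableEquiv_toLp (Fin 2))

theorem shearTranspose_planePoint (s x y : ℝ) :
    shearTranspose s (planePoint (x, y)) = planePoint (x, y + s * x) := by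
  ext i
  fin_cases i <;> simp [shearTranspose, planePoint, shearMatrix, Matrix.toLpLin_apply,
    add_comm]

/-- Fubini reduces this to almost every line `x ≠ 0`; terms with equal shear index `p.1` are
collected into one coefficient `Q j`. -/
theorem ae_eq_zero_of_plane_recurrence {s : Finset (ℤ × (Fin 2 → ℤ))}
    {c : ℤ × (Fin 2 → ℤ) → ℂ} (hs : s.Nonempty) (hc : ∀ p ∈ s, c p ≠ 0)
    {G : ℝ × ℝ → ℂ} (hG : Measurable G) (hG2 : ∫⁻ z, ‖G z‖ₑ ^ 2 ≠ ∞)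
    (hrel : ∀ᵐ z : ℝ × ℝ, ∑ p ∈ s, c p * (lineChar (p.2 0) z.1 * lineChar (p.2 1) z.2 *
      G (z.1, z.2 + p.1 * z.1)) = 0) :
    ∀ᵐ z : ℝ × ℝ, G z = 0 := by
  obtain ⟨pa, hpa, hmin⟩ := s.exists_min_image (fun p => p.1) hs
  obtain ⟨pb, hpb, hmax⟩ := s.exists_max_image (fun p => p.1) hs
  set a := pa.1
  let δ : ℤ × (Fin 2 → ℤ) → ℕ := fun p => (p.1 - a).toNat
  have hδ : ∀ p ∈ s, p.1 = a + δ p := fun p hp => by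
    have := hmin p hp
    simp only [δ]
    omega
  let d := δ pb
  have hδd : ∀ p ∈ s, δ p ∈ Finset.range (d + 1) := fun p hp => by
    have := hmax p hp
    simp only [δ, d, Finset.mem_range]
    omega
  have hne : ∀ q ∈ s, ∀ᵐ x : ℝ, ∀ᵐ y : ℝ, ∑ p ∈ s with δ p = δ q,
      c p * (lineChar (p.2 0) x * lineChar (p.2 1) y) ≠ 0 := by
    intro q hq
    refine ae_ae_trigPolynomial_ne_zero (τ := Prod.snd) (fun p hp p' hp' h => ?_)
      ⟨q, by simp [hq]⟩ fun p hp => hc p (Finset.mem_filter.1 hp).1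
    rw [Finset.mem_coe, Finset.mem_filter] at hp hp'
    refine Prod.ext ?_ h
    rw [hδ p hp.1, hδ p' hp'.1, hp.2, hp'.2]
  have hfin : ∀ᵐ x : ℝ, ∫⁻ y, ‖G (x, y)‖ₑ ^ 2 < ∞ := by
    have hm : Measurable fun z : ℝ × ℝ => ‖G z‖ₑ ^ 2 := by fun_prop
    refine ae_lt_top hm.lintegral_prod_right' ?_
    rwa [← lintegral_prod _ hm.aemeasurable, ← Measure.volume_eq_prod]
  have hrel' := Measure.ae_ae_of_ae_prod (Measure.volume_eq_prod ℝ ℝ ▸ hrel)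
  have hx0 : ∀ᵐ x : ℝ, x ≠ 0 := by simp [ae_iff]
  rw [Measure.volume_eq_prod, Measure.ae_prod_iff_ae_ae
    (p := fun z => G z = 0) (hG (measurableSet_singleton 0))]
  filter_upwards [hne pa hpa, hne pb hpb, hfin, hrel', hx0] with x ha hb hf hr hx
  refine ae_eq_zero_of_periodic_recurrence (d := d) (a := a)
    (Q := fun j y => ∑ p ∈ s with δ p = j, c p * (lineChar (p.2 0) x * lineChar (p.2 1) y)) hx
    (fun j y => ?_) ?_ hb (by fun_prop) hf.ne ?_
  · simp only [lineChar_periodic _ y]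
  · have hpa0 : δ pa = 0 := by simp [δ, a]
    rwa [hpa0] at ha
  · filter_upwards [hr] with y hy
    rw [← hy, ← Finset.sum_fiberwise_of_maps_to hδd]
    refine Finset.sum_congr rfl fun j _ => ?_
    rw [Finset.sum_mul]
    refine Finset.sum_congr rfl fun p hp => ?_
    rw [Finset.mem_filter] at hp
    rw [hδ p hp.1, hp.2, mul_assoc]

theorem mainTheorem6 (f : L2Plane) (hf : f ≠ 0) :
    LinearIndependent ℂ (fun p : ℤ × (Fin 2 → ℤ) =>
      shearletTransform 1 (p.1 : ℝ) one_pos (intVector p.2) f) := by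
  rw [linearIndependent_iff']
  intro s₀ c hsum
  by_contra! hcon
  obtain ⟨p₀, hp₀, hcp₀⟩ := hcon
  refine hf ?_
  let F : L2Plane := 𝓕 f
  -- Zero coefficients are dropped so that the extreme shear indices carry nontrivial polynomials.
  let s := s₀.filter fun p => c p ≠ 0
  have hsum' : ∑ p ∈ s, c p • shearletTransform 1 (p.1 : ℝ) one_pos (intVector p.2) f = 0 := by
    rw [← hsum]
    refine Finset.sum_filter_of_ne fun p _ h hc => h (by rw [hc, zero_smul])
  have hF : ∀ᵐ ξ, ∑ p ∈ s, c p * (modulation (intVector p.2) ξ * F (shearTranspose p.1 ξ)) = 0 := by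
    have h1 : ∑ p ∈ s, c p • (𝓕 (shearletTransform 1 (p.1 : ℝ) one_pos (intVector p.2) f) :
        L2Plane) = 0 := by
      have := congrArg (Lp.fourierTransformₗᵢ (EuclideanSpace ℝ (Fin 2)) ℂ) hsum'
      rw [map_sum, map_zero] at this
      rw [← this]
      exact Finset.sum_congr rfl fun p _ => (map_smul _ _ _).symm
    have h2 : ∀ᵐ ξ, ∀ p : ℤ × (Fin 2 → ℤ),
        (c p • (𝓕 (shearletTransform 1 (p.1 : ℝ) one_pos (intVector p.2) f) : L2Plane) :
          L2Plane) ξ = c p * (modulation (intVector p.2) ξ * F (shearTranspose p.1 ξ)) := by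
      rw [ae_all_iff]
      intro p
      filter_upwards [shearletTransform_fourier p.1 (intVector p.2) f, Lp.coeFn_smul (c p)
        (𝓕 (shearletTransform 1 (p.1 : ℝ) one_pos (intVector p.2) f) : L2Plane)] with ξ h3 h4
      rw [h4, Pi.smul_apply, h3, smul_eq_mul]
    have h5 := Lp.coeFn_finsetSum s fun p =>
      c p • (𝓕 (shearletTransform 1 (p.1 : ℝ) one_pos (intVector p.2) f) : L2Plane)
    rw [h1] at h5
    filter_upwards [h2, h5, Lp.coeFn_zero ℂ 2 (volume : Measure (EuclideanSpace ℝ (Fin 2)))]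
      with ξ h6 h7 h8
    rw [h8, Finset.sum_apply] at h7
    rw [← Finset.sum_congr rfl fun p _ => h6 p]
    exact h7.symm
  have hFm : Measurable F := (Lp.stronglyMeasurable F).measurable
  have hG := ae_eq_zero_of_plane_recurrence (s := s) (c := c) ⟨p₀, by simp [s, hp₀, hcp₀]⟩
    (fun p hp => (Finset.mem_filter.1 hp).2) (G := fun z => F (planePoint z))
    (hFm.comp measurePreserving_planePoint.measurable) ?_ ?_
  · have hF0 : F = 0 := by
      refine Lp.ext ?_
      filter_upwards [measurePreserving_planeCoords.quasiMeasurePreserving.ae hG,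
        Lp.coeFn_zero ℂ 2 (volume : Measure (EuclideanSpace ℝ (Fin 2)))] with ξ h1 h2
      rw [h2, Pi.zero_apply, ← h1]
      congr 1
      ext i
      fin_cases i <;> rfl
    exact (Lp.fourierTransformₗᵢ (EuclideanSpace ℝ (Fin 2)) ℂ).map_eq_zero_iff.1 hF0
  · have h := measurePreserving_planePoint.lintegral_comp (f := fun ξ => ‖F ξ‖ₑ ^ 2) (by fun_prop)
    rw [h]
    have h2 := eLpNorm_lt_top_iff_lintegral_rpow_enorm_lt_top (p := 2) (by simp) (by simp)
      |>.1 (Lp.eLpNorm_lt_top F)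
    simpa using h2.ne
  · filter_upwards [measurePreserving_planePoint.quasiMeasurePreserving.ae hF] with z hz
    rw [← hz]
    refine Finset.sum_congr rfl fun p _ => ?_
    rw [modulation_intVector, shearTranspose_planePoint]
    rfl
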